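/- Let $r\ge 1$, and order $\mathbb N^r$ componentwise. A \emph{good semigroup} of $\mathbb N^r$ is a submonoid $S$ of $(\mathbb N^r,+)$ such that: (i) $\min(a,b)\in S$ for all $a,b\in S$; (ii) if $a,b\in S$ and $a[i]=b[i]$, there is $c\in S$ with $c[i]>a[i]$, $c[j]\ge\min(a[j],b[j])$ for all $j\ne i$, and $c[j]=\min(a[j],b[j])$ whenever $a[j]\ne b[j]$; (iii) there is $\delta\in S$ with $\delta+\mathbb N^r\subseteq S$. It is \emph{local} if $\mathbf 0$ is its only element with a zero component, and \emph{Arf} if $S(\alpha)-\alpha$ is closed under addition for every $\alpha\in S$, where $S(\alpha)=\{\beta\in S:\beta\ge\alpha\}$. Its \emph{conductor} is the least $\delta$ with $\delta+\mathbb N^r\subseteq S$. With $C=\delta+\mathbb N^r$, its \emph{genus} is $g(S)=d(\mathbb N^r\setminus C)-d(S\setminus C)$, where $d(\mathbb N^r\setminus C)$ and $d(S\setminus C)$ are the lengths of saturated chains from $\mathbf 0$ to $\delta$ in $\mathbb N^r$ and in $S$, respectively (a chain is saturated if it cannot be refined in the set considered). Let $T$ be an infinite rooted tree with branches $1,\dots,r$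 and levels $1,2,\dots$, all branches sharing the root at level $1$. The node of the $i$-th branch at level $j$ carries a vector $\mathbf n_i^j\in\mathbb N^r$. Two branches are \emph{glued} at level $j$ if they have the same node there; they are then glued at all lower levels. Let $S(T)$ consist of $\mathbf 0$ and all the sums $\sum_{\mathbf n\in T'}\mathbf n$, where $T'$ ranges over the finite subtrees of $T$ containing the root. $T$ is a \emph{multiplicity tree of a local Arf good semigroup} if $S(T)$ is a local Arf good semigroup and, for all $i,j,h$, $\mathbf n_i^j[h]=0$ if and only if the node is not in the $h$-th branch. $T$ is \emph{untwisted} if, for all $i<h$, branches $i$ and $h$ are glued at level $l$ if and only if, for every $i\le k<h$, branches $k$ and $k+1$ are glued at some level $\ge l$. A \emph{multiplicity sequence} is a nonincreasing sequence $M=(m_j)_{j\ge1}$ of positive integers that is eventually equal to $1$ and such that for every $j$ there is $l\ge j+1$ with $m_j=\sum_{k=j+1}^{l}m_k$. Put $\mathrm{AS}(M)=\{0,\,m_1,\,m_1+m_2,\,\dots\}$ and $g(\mathrm{AS}(M))=|\mathbb N\setminus \mathrm{AS}(M)|$. \textbf{Theorem.} Let $T$ be an untwisted multiplicity tree of a local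 Arf good semigroup $S(T)\subseteq\mathbb N^r$. For $1\le k\le r$ let $M_k=(\mathbf n_k^j[k])_{j\ge1}$ be the sequence along the $k$-th branch, and for $1\le k\le r-1$ let $p_k$ be the highest level at which branches $k$ and $k+1$ are glued. Then each $M_k$ is a multiplicity sequence, the genus of $S(T)$ is well defined (it exists and does not depend on the choice of the saturated chains), and $$g(S(T))=\sum_{k=1}^{r}g(\mathrm{AS}(M_k))+\sum_{k=1}^{r-1}p_k .$$ -/

import Mathlib

/-- A good semigroup of `ℕ^r`. -/
structure IsGoodSemigroup {r : ℕ} (S : AddSubmonoid (Fin r → ℕ)) : Prop where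
  inf_mem : ∀ a ∈ S, ∀ b ∈ S, a ⊓ b ∈ S
  exists_gt : ∀ a ∈ S, ∀ b ∈ S, ∀ i, a i = b i →
    ∃ c ∈ S, a i < c i ∧ (∀ j, j ≠ i → min (a j) (b j) ≤ c j) ∧
      ∀ j, a j ≠ b j → c j = min (a j) (b j)
  exists_add_mem : ∃ δ ∈ S, ∀ x : Fin r → ℕ, δ + x ∈ S

/-- `S` is local: zero is the only element of `S` with a zero component. -/
def IsLocalSemigroup {r : ℕ} (S : AddSubmonoid (Fin r → ℕ)) : Prop :=
  ∀ a ∈ S, (∃ i, a i = 0) → a = 0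

/-- The Arf property. Here `{x | α + x ∈ S}` is `S(α) - α`, where
`S(α) = {β ∈ S | α ≤ β}`; it has to be closed under addition for every `α ∈ S`. -/
def HasArfProperty {r : ℕ} (S : AddSubmonoid (Fin r → ℕ)) : Prop :=
  ∀ α ∈ S, ∀ x y : Fin r → ℕ, α + x ∈ S → α + y ∈ S → α + (x + y) ∈ S

/-- A local Arf good semigroup of `ℕ^r`. -/
structure IsLocalArfSemigroup {r : ℕ} (S : AddSubmonoid (Fin r → ℕ)) : Prop where
  good : IsGoodSemigroup S
  isLocal : IsLocalSemigroup S
  arf : HasArfProperty S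

/-- `δ` is the conductor of `S`: the least vector with `δ + ℕ^r ⊆ S`. -/
def IsConductor {r : ℕ} (S : AddSubmonoid (Fin r → ℕ)) (δ : Fin r → ℕ) : Prop :=
  IsLeast {c : Fin r → ℕ | ∀ x : Fin r → ℕ, c + x ∈ S} δ

/-- There is a saturated chain `α = α₀ < α₁ < ⋯ < αₙ = β` of length `n` in `S`: between two
consecutive terms there is no further element of `S`. -/
def HasSaturatedChain {r : ℕ} (S : AddSubmonoid (Fin r → ℕ)) (α β : Fin r → ℕ) (n : ℕ) : Prop :=
  ∃ c : RelSeries {x : S × S | x.1 ⋖ x.2},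
    (c.head : Fin r → ℕ) = α ∧ (c.last : Fin r → ℕ) = β ∧ c.length = n

/-- `g` is a genus of `S`: if `δ` is the conductor and `C = δ + ℕ^r`, then
`g = d(ℕ^r ∖ C) - d(S ∖ C)`, the two terms being the lengths of saturated chains from `0` to `δ`
in `ℕ^r` and in `S`. A priori `g` could depend on the chains; that it does not is part of what
`∀ g, IsGenus S g ↔ g = g₀` says. -/
def IsGenus {r : ℕ} (S : AddSubmonoid (Fin r → ℕ)) (g : ℤ) : Prop :=
  ∃ (δ : Fin r → ℕ) (m n : ℕ), IsConductor S δ ∧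
    HasSaturatedChain (⊤ : AddSubmonoid (Fin r → ℕ)) 0 δ m ∧
    HasSaturatedChain S 0 δ n ∧ g = (m : ℤ) - (n : ℤ)

/-- A multiplicity sequence `m₁ ≥ m₂ ≥ ⋯`, with `m_{j+1}` written `M j`. -/
structure IsMultiplicitySequence (M : ℕ → ℕ) : Prop where
  pos : ∀ j, 0 < M j
  antitone : Antitone M
  eventually_one : ∃ k, ∀ j, k ≤ j → M j = 1
  eq_sum : ∀ j, ∃ l, j + 1 ≤ l ∧ M j = ∑ k ∈ Finset.Icc (j + 1) l, M k

/-- `AS(M) = {0, m₁, m₁ + m₂, m₁ + m₂ + m₃, …}`. -/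
def arfNumericalSet (M : ℕ → ℕ) : Set ℕ :=
  {x | ∃ k, x = ∑ j ∈ Finset.range k, M j}

/-- The genus of a numerical semigroup: the number of its gaps. -/
noncomputable def numericalGenus (A : Set ℕ) : ℕ :=
  (Aᶜ).ncard

/-- An infinite rooted tree with `r` branches whose nodes carry vectors of `ℕ^r`.
The levels `1, 2, 3, …` are indexed by `0, 1, 2, …`. The relation `glued j` holds between two
branches that have the same node at the level of index `j`, so that the nodes of that level are
the classes of `glued j`; all branches are glued at the root, and branches that are glued
at some level are glued at the preceding one. -/
structure VectorTree (r : ℕ) where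
  glued : ℕ → Setoid (Fin r)
  glued_zero : glued 0 = ⊤
  glued_succ_le : ∀ j, glued (j + 1) ≤ glued j
  vec : (j : ℕ) → Quotient (glued j) → Fin r → ℕ

namespace VectorTree

/-- The branches `i` and `h` are glued at the level of index `j`. -/
def Glued {r : ℕ} (T : VectorTree r) (j : ℕ) (i h : Fin r) : Prop :=
  T.glued j i h

/-- The nodes of the tree: a level together with a class of branches glued there. -/
abbrev Node {r : ℕ} (T : VectorTree r) : Type :=
  Σ j : ℕ, Quotient (T.glued j)

/-- The node of the `i`-th branch at the level of index `j`. -/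
def node {r : ℕ} (T : VectorTree r) (i : Fin r) (j : ℕ) : T.Node :=
  ⟨j, Quotient.mk (T.glued j) i⟩

/-- The vector that a node carries. -/
def nodeVec {r : ℕ} (T : VectorTree r) (v : T.Node) : Fin r → ℕ :=
  T.vec v.1 v.2

/-- A finite set of nodes is a subtree rooted in the root of `T`. -/
structure IsRootedSubtree {r : ℕ} (T : VectorTree r) (F : Finset T.Node) : Prop where
  root_mem : ∀ i, T.node i 0 ∈ F
  parent_mem : ∀ i j, T.node i (j + 1) ∈ F → T.node i j ∈ F

/-- The set `S(T)`: zero and the sums of the nodes of the finite subtrees rooted in the root. -/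
def sums {r : ℕ} (T : VectorTree r) : Set (Fin r → ℕ) :=
  {0} ∪ {x | ∃ F : Finset T.Node, T.IsRootedSubtree F ∧ x = ∑ v ∈ F, T.nodeVec v}

/-- `T` is the multiplicity tree of the local Arf semigroup `S`: a component of a node is zero
exactly when the node is not in the corresponding branch, and `S = S(T)`. -/
structure IsMultiplicityTree {r : ℕ} (T : VectorTree r) (S : AddSubmonoid (Fin r → ℕ)) :
    Prop where
  isLocalArf : IsLocalArfSemigroup S
  eq_zero_iff : ∀ i j h, T.nodeVec (T.node i j) h = 0 ↔ ¬ T.Glued j i h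
  eq_sums : (S : Set (Fin r → ℕ)) = T.sums

/-- The multiplicity sequence `M_i` along the `i`-th branch. -/
def branchSeq {r : ℕ} (T : VectorTree r) (i : Fin r) (j : ℕ) : ℕ :=
  T.nodeVec (T.node i j) i

/-- `p` is the highest level at which the branches `i` and `h` are glued (the level of index `j`
is level `j + 1`). -/
def IsHighestGluedLevel {r : ℕ} (T : VectorTree r) (i h : Fin r) (p : ℕ) : Prop :=
  IsGreatest {l : ℕ | ∃ j, l = j + 1 ∧ T.Glued j i h} p

/-- The tree is untwisted: two branches are glued at a level if and only if all the pairs of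
consecutive branches between them are glued at that level or a higher one. -/
def IsUntwisted {n : ℕ} (T : VectorTree (n + 1)) : Prop :=
  ∀ (l : ℕ) (i h : Fin (n + 1)), i < h →
    (T.Glued l i h ↔ ∀ k : Fin n, i ≤ k.castSucc → k.succ ≤ h →
      ∃ m, l ≤ m ∧ T.Glued m k.castSucc k.succ)

end VectorTree

/-!
A node of the tree lies on some number of branches, and the `i`-th component of the sum of a finite
subtree is a partial sum of `branchSeq i`. As these partial sums strictly increase, taking sums is
an isomorphism from the finite subtrees, ordered by inclusion, onto `S`. A covering step between
subtrees adds one node, so every saturated chain in `S` from `0` to the sum of a subtree `F` has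
length `#F`, while in `ℕ^r` its length is the sum of the coordinates.

Let the sum of `F` be the conductor and let `h i` be the number of nodes of `F` on the branch `i`.
The `i`-th coordinate of the conductor exceeds `h i` by the number of gaps of `AS (branchSeq i)`,
and `∑ i, h i` exceeds `#F` by the number of branches through a node minus one, summed over all
nodes of `F`. This computes the genus of every tree. In an untwisted tree the branches through a
node form an interval, so that their number minus one is the number of consecutive pairs among them,
and the `k`-th consecutive pair shares exactly `p k` nodes.
-/

open Finset

theorem card_filter_castSucc_succ_mem_add_one {n : ℕ} {C : Finset (Fin (n + 1))}
    (hne : C.Nonempty) (hC : (C : Set (Fin (n + 1))).OrdConnected) :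
    #{k : Fin n | k.castSucc ∈ C ∧ k.succ ∈ C} + 1 = #C := by
  rw [← card_erase_add_one (C.min'_mem hne), ← card_map (Fin.succEmb n)]
  congr 2
  ext c
  simp only [mem_map, mem_filter, mem_univ, true_and, mem_erase, Fin.coe_succEmb]
  constructor
  · rintro ⟨k, ⟨hk, hk'⟩, rfl⟩
    exact ⟨((C.min'_le _ hk).trans_lt k.castSucc_lt_succ).ne', hk'⟩
  · rintro ⟨hc, hcC⟩
    have hlt : C.min' hne < c := (C.min'_le _ hcC).lt_of_ne' hc
    obtain ⟨k, rfl⟩ := Fin.exists_succ_eq.2 (Fin.ne_zero_of_lt hlt)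
    exact ⟨k, ⟨hC.out (C.min'_mem hne) hcC
      ⟨Fin.le_castSucc_iff.2 hlt, k.castSucc_lt_succ.le⟩, hcC⟩, rfl⟩

section Chains

theorem relSeries_apply_last {α : Type*} {s : SetRel α α} (f : α → ℕ)
    (hf : ∀ a b, (a, b) ∈ s → f b = f a + 1) (c : RelSeries s) :
    f c.last = f c.head + c.length := by
  induction c using RelSeries.inductionOn with
  | singleton a => simp
  | cons c a hac ih =>
    rw [RelSeries.last_cons, RelSeries.head_cons, ih, hf _ _ hac, RelSeries.cons_length]
    omega

theorem exists_relSeries_covBy_of_le {α : Type*} [PartialOrder α] [LocallyFiniteOrder α] {a b : α}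
    (hab : a ≤ b) :
    ∃ c : RelSeries {x : α × α | x.1 ⋖ x.2}, c.head = a ∧ c.last = b := by
  induction le_iff_reflTransGen_covBy.1 hab with
  | refl => exact ⟨RelSeries.singleton _ a, rfl, rfl⟩
  | @tail x y hax hxy ih =>
    obtain ⟨c, hhead, hlast⟩ := ih (le_iff_reflTransGen_covBy.2 hax)
    exact ⟨c.snoc y (hlast ▸ hxy), by rw [RelSeries.head_snoc, hhead], RelSeries.last_snoc ..⟩

theorem sum_eq_sum_add_one_of_covBy {ι : Type*} [Fintype ι] {a b : ι → ℕ} (hab : a ⋖ b) :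
    ∑ i, b i = ∑ i, a i + 1 := by
  classical
  obtain ⟨i, hi, hne⟩ := Pi.covBy_iff.1 hab
  rw [← add_sum_erase _ _ (mem_univ i), ← add_sum_erase _ a (mem_univ i),
    ← Order.covBy_iff_add_one_eq.1 hi, sum_congr rfl fun j hj => (hne j (ne_of_mem_erase hj)).symm,
    add_right_comm]

variable {r : ℕ} {S : AddSubmonoid (Fin r → ℕ)} {α β : Fin r → ℕ}

theorem exists_hasSaturatedChain (hα : α ∈ S) (hβ : β ∈ S) (h : α ≤ β) :
    ∃ n, HasSaturatedChain S α β n := by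
  classical
  let _ : LocallyFiniteOrder S := Subtype.instLocallyFiniteOrder (· ∈ S)
  obtain ⟨c, hhead, hlast⟩ := exists_relSeries_covBy_of_le (show (⟨α, hα⟩ : S) ≤ ⟨β, hβ⟩ from h)
  exact ⟨c.length, c, by rw [hhead], by rw [hlast], rfl⟩

theorem HasSaturatedChain.sum_eq_sum_add_length {m : ℕ}
    (h : HasSaturatedChain (⊤ : AddSubmonoid (Fin r → ℕ)) α β m) :
    ∑ i, β i = ∑ i, α i + m := by
  obtain ⟨c, rfl, rfl, rfl⟩ := h
  refine relSeries_apply_last (fun a : (⊤ : AddSubmonoid (Fin r → ℕ)) => ∑ i, (a : Fin r → ℕ) i)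
    (fun a b hab => ?_) c
  have hconv : (Set.range (OrderEmbedding.subtype
      (· ∈ (⊤ : AddSubmonoid (Fin r → ℕ))))).OrdConnected := by
    rw [Set.range_eq_univ.2 fun x => ⟨⟨x, trivial⟩, rfl⟩]
    exact Set.ordConnected_univ
  exact sum_eq_sum_add_one_of_covBy ((hconv.apply_covBy_apply_iff _).2 hab)

theorem IsGoodSemigroup.exists_isConductor (hS : IsGoodSemigroup S) : ∃ δ, IsConductor S δ := by
  obtain ⟨c, -, hc⟩ := hS.exists_add_mem
  obtain ⟨δ, hδ, hmin⟩ := wellFounded_lt.has_min {c | ∀ x, c + x ∈ S} ⟨c, hc⟩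
  refine ⟨δ, hδ, fun b hb => ?_⟩
  have hinf : ∀ x, δ ⊓ b + x ∈ S := fun x => by
    have hdistrib : δ ⊓ b + x = (δ + x) ⊓ (b + x) := funext fun i => min_add_add_right .. |>.symm
    exact hdistrib ▸ hS.inf_mem _ (hδ x) _ (hb x)
  by_contra hle
  exact hmin _ hinf (inf_lt_left.2 hle)

end Chains

section MultiplicitySequence

variable {M : ℕ → ℕ}

theorem strictMono_sum_range (hpos : ∀ j, 0 < M j) : StrictMono fun m => ∑ j ∈ range m, M j :=
  strictMono_nat_of_lt_succ fun m => by
    rw [sum_range_succ]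
    exact Nat.lt_add_of_pos_right (hpos m)

theorem numericalGenus_arfNumericalSet_add (hpos : ∀ j, 0 < M j) {m : ℕ}
    (hm : Set.Ici (∑ j ∈ range m, M j) ⊆ arfNumericalSet M) :
    numericalGenus (arfNumericalSet M) + m = ∑ j ∈ range m, M j := by
  have hmono := strictMono_sum_range hpos
  let A : Finset ℕ := (range m).image fun k => ∑ j ∈ range k, M j
  have hA : A ⊆ range (∑ j ∈ range m, M j) :=
    image_subset_iff.2 fun k hk => mem_range.2 (hmono (mem_range.1 hk))
  have hcard : #A = m := by rw [card_image_of_injective _ hmono.injective, card_range]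
  have hgaps : (arfNumericalSet M)ᶜ = ↑(range (∑ j ∈ range m, M j) \ A) := by
    ext y
    rw [Set.mem_compl_iff, mem_coe, mem_sdiff, mem_range, mem_image]
    constructor
    · exact fun hy => ⟨not_le.1 fun hle => hy (hm hle), fun ⟨k, _, hk⟩ => hy ⟨k, hk.symm⟩⟩
    · rintro ⟨hlt, hy⟩ ⟨k, rfl⟩
      exact hy ⟨k, mem_range.2 (hmono.lt_iff_lt.1 hlt), rfl⟩
  rw [numericalGenus, hgaps, Set.ncard_coe_finset]
  simpa only [hcard, card_range] using card_sdiff_add_card_eq_card hA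

theorem eq_one_of_Ici_subset_arfNumericalSet (hpos : ∀ j, 0 < M j) {m j : ℕ}
    (hm : Set.Ici (∑ j ∈ range m, M j) ⊆ arfNumericalSet M) (hj : m ≤ j) : M j = 1 := by
  have hmono := strictMono_sum_range hpos
  obtain ⟨k, hk⟩ := hm (show _ ≤ ∑ l ∈ range j, M l + 1 from
    (hmono.monotone hj).trans (Nat.le_succ _))
  have hjk : j < k := hmono.lt_iff_lt.1 (show ∑ l ∈ range j, M l < ∑ l ∈ range k, M l by omega)
  have hle : ∑ l ∈ range (j + 1), M l ≤ ∑ l ∈ range k, M l := hmono.monotone hjk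
  rw [sum_range_succ] at hle
  have := hpos j
  omega

theorem exists_eq_sum_Icc (hpos : ∀ j, 0 < M j) {j : ℕ}
    (hj : ∑ l ∈ range (j + 1), M l + M j ∈ arfNumericalSet M) :
    ∃ l, j + 1 ≤ l ∧ M j = ∑ k ∈ Icc (j + 1) l, M k := by
  obtain ⟨k, hk⟩ := hj
  have hjk : j + 1 < k := (strictMono_sum_range hpos).lt_iff_lt.1
    (show ∑ l ∈ range (j + 1), M l < ∑ l ∈ range k, M l from
      hk ▸ Nat.lt_add_of_pos_right (hpos j))
  obtain ⟨l, rfl⟩ := Nat.exists_eq_succ_of_ne_zero (Nat.ne_zero_of_lt hjk)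
  refine ⟨l, Nat.lt_succ_iff.1 hjk, ?_⟩
  rw [← sum_range_add_sum_Ico M hjk.le] at hk
  exact Nat.add_left_cancel hk

theorem isMultiplicitySequence_of_mem_arfNumericalSet (hpos : ∀ j, 0 < M j)
    (hArf : ∀ j, ∑ l ∈ range (j + 1), M l + M j ∈ arfNumericalSet M)
    (hIci : ∃ m, Set.Ici (∑ j ∈ range m, M j) ⊆ arfNumericalSet M) :
    IsMultiplicitySequence M where
  pos := hpos
  antitone := antitone_nat_of_succ_le fun j => by
    obtain ⟨l, hl, hsum⟩ := exists_eq_sum_Icc hpos (hArf j)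
    exact hsum ▸ single_le_sum (f := M) (fun _ _ => Nat.zero_le _) (left_mem_Icc.2 hl)
  eventually_one := hIci.imp fun _ hm _ => eq_one_of_Ici_subset_arfNumericalSet hpos hm
  eq_sum j := exists_eq_sum_Icc hpos (hArf j)

end MultiplicitySequence

namespace VectorTree

variable {r : ℕ} {T : VectorTree r}

section Nodes

theorem Glued.mono {j l : ℕ} {i k : Fin r} (h : T.Glued j i k) (hl : l ≤ j) : T.Glued l i k :=
  antitone_nat_of_succ_le T.glued_succ_le hl h

theorem node_eq_node_iff {i k : Fin r} {j : ℕ} : T.node i j = T.node k j ↔ T.Glued j i k := by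
  rw [node, node, Sigma.mk.injEq, heq_eq_eq, Quotient.eq]
  exact and_iff_right rfl

theorem node_injective (T : VectorTree r) (i : Fin r) : Function.Injective (T.node i) :=
  fun _ _ h => congrArg Sigma.fst h

theorem exists_node_eq (v : T.Node) : ∃ i j, T.node i j = v := by
  obtain ⟨j, q⟩ := v
  obtain ⟨i, rfl⟩ := Quotient.exists_rep q
  exact ⟨i, j, rfl⟩

open Classical in
/-- The set of the branches that pass through the node `v`. -/
noncomputable def branchesThrough (T : VectorTree r) (v : T.Node) : Finset (Fin r) :=
  {i | T.node i v.1 = v}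

theorem mem_branchesThrough {i : Fin r} {v : T.Node} :
    i ∈ T.branchesThrough v ↔ T.node i v.1 = v := by
  simp [branchesThrough]

theorem mem_branchesThrough_node {i k : Fin r} {j : ℕ} :
    k ∈ T.branchesThrough (T.node i j) ↔ T.Glued j k i :=
  mem_branchesThrough.trans node_eq_node_iff

theorem branchesThrough_nonempty (v : T.Node) : (T.branchesThrough v).Nonempty := by
  obtain ⟨i, j, rfl⟩ := exists_node_eq v
  exact ⟨i, mem_branchesThrough.2 rfl⟩

end Nodes

section Subtrees

/-- The finite subtrees of `T`: finite sets of nodes closed under passing to the parent, ordered by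
inclusion. Unlike in `IsRootedSubtree`, the empty set is allowed, so that `0` is also a sum. -/
abbrev Subtree (T : VectorTree r) : Type :=
  {F : Finset T.Node // ∀ i j, T.node i (j + 1) ∈ F → T.node i j ∈ F}

namespace Subtree

/-- The sum of the nodes of a subtree. -/
def sum (F : T.Subtree) : Fin r → ℕ :=
  ∑ v ∈ F.1, T.nodeVec v

/-- The number of nodes of a subtree on the `i`-th branch, encoded as the index of the first level
at which the subtree misses that branch. -/
noncomputable def height (F : T.Subtree) (i : Fin r) : ℕ :=
  sInf {j | T.node i j ∉ F.1}

variable {F G : T.Subtree} {i : Fin r}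

theorem node_mem_of_le {j l : ℕ} (hjl : j ≤ l) (hl : T.node i l ∈ F.1) : T.node i j ∈ F.1 := by
  induction hjl with
  | refl => exact hl
  | step _ ih => exact ih (F.2 _ _ hl)

theorem node_mem_iff {j : ℕ} : T.node i j ∈ F.1 ↔ j < F.height i := by
  have hne : {j | T.node i j ∉ F.1}.Nonempty :=
    (F.1.finite_toSet.preimage (T.node_injective i).injOn).infinite_compl.nonempty
  refine ⟨fun hj => not_le.1 fun hle => Nat.sInf_mem hne (node_mem_of_le hle hj), fun hj => ?_⟩
  exact not_not.1 (Nat.notMem_of_lt_sInf hj)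

theorem le_iff_height_le : F ≤ G ↔ ∀ i, F.height i ≤ G.height i := by
  refine ⟨fun hFG i => le_of_forall_lt fun j hj => ?_, fun h v hv => ?_⟩
  · exact node_mem_iff.1 (hFG (node_mem_iff.2 hj))
  · obtain ⟨i, j, rfl⟩ := exists_node_eq v
    exact node_mem_iff.2 ((node_mem_iff.1 hv).trans_le (h i))

theorem filter_mem_branchesThrough (F : T.Subtree) (i : Fin r) :
    {v ∈ F.1 | i ∈ T.branchesThrough v} =
      (range (F.height i)).map ⟨T.node i, T.node_injective i⟩ := by
  ext v
  simp only [mem_filter, mem_branchesThrough, mem_map, mem_range, ← node_mem_iff,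
    Function.Embedding.coeFn_mk]
  constructor
  · exact fun ⟨hv, hi⟩ => ⟨v.1, hi ▸ hv, hi⟩
  · rintro ⟨j, hj, rfl⟩
    exact ⟨hj, rfl⟩

theorem sum_card_branchesThrough (F : T.Subtree) :
    ∑ v ∈ F.1, #(T.branchesThrough v) = ∑ i, F.height i := by
  calc ∑ v ∈ F.1, #(T.branchesThrough v)
      = ∑ v ∈ F.1, #{i | i ∈ T.branchesThrough v} := by simp only [filter_univ_mem]
    _ = ∑ i, #{v ∈ F.1 | i ∈ T.branchesThrough v} :=
      sum_card_bipartiteAbove_eq_sum_card_bipartiteBelow fun v i => i ∈ T.branchesThrough v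
    _ = ∑ i, F.height i := by simp only [filter_mem_branchesThrough, card_map, card_range]

theorem card_of_covBy (hFG : F ⋖ G) : #G.1 = #F.1 + 1 := by
  classical
  obtain ⟨v, hv, hmin⟩ := exists_min_image (G.1 \ F.1) Sigma.fst (sdiff_nonempty.2 hFG.lt.not_ge)
  obtain ⟨hvG, hvF⟩ := mem_sdiff.1 hv
  have hparent : ∀ i j, T.node i (j + 1) ∈ insert v F.1 → T.node i j ∈ insert v F.1 := by
    intro i j hij
    refine mem_insert_of_mem ?_
    rcases mem_insert.1 hij with rfl | hij
    · by_contra hj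
      exact (hmin _ (mem_sdiff.2 ⟨G.2 i j hvG, hj⟩)).not_gt (Nat.lt_succ_self j)
    · exact F.2 i j hij
  let H : T.Subtree := ⟨insert v F.1, hparent⟩
  have hFH : F < H := ssubset_insert hvF
  have hHG : H ≤ G := insert_subset hvG hFG.le
  have hG : H = G := hHG.eq_of_not_lt (hFG.2 hFH)
  rw [← hG]
  exact card_insert_of_notMem hvF

open Classical in
/-- The subtree of all nodes on the first `j` levels. -/
noncomputable def truncation (T : VectorTree r) (j : ℕ) : T.Subtree :=
  ⟨(range j).sigma fun _ => univ, fun i l hl => by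
    simp only [mem_sigma, mem_range, mem_univ, and_true] at hl ⊢
    exact Nat.lt_of_succ_lt hl⟩

theorem height_truncation (j : ℕ) (i : Fin r) : (truncation T j).height i = j :=
  eq_of_forall_lt_iff fun l => by
    rw [← node_mem_iff]
    simp [truncation, node]

theorem truncation_zero_val : (truncation T 0).1 = ∅ :=
  rfl

theorem sum_truncation_zero : (truncation T 0).sum = 0 := by
  rw [sum, truncation_zero_val, sum_empty]

end Subtree

theorem mem_sums_iff {x : Fin r → ℕ} : x ∈ T.sums ↔ ∃ F : T.Subtree, F.sum = x := by
  constructor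
  · rintro (rfl | ⟨F, hF, rfl⟩)
    · exact ⟨_, Subtree.sum_truncation_zero⟩
    · exact ⟨⟨F, hF.parent_mem⟩, rfl⟩
  · rintro ⟨F, rfl⟩
    rcases F.1.eq_empty_or_nonempty with hempty | ⟨v, hv⟩
    · exact Or.inl (by rw [Set.mem_singleton_iff, Subtree.sum, hempty, sum_empty])
    · obtain ⟨i, j, rfl⟩ := exists_node_eq v
      have hroot : T.node i 0 ∈ F.1 := Subtree.node_mem_of_le (Nat.zero_le j) hv
      refine Or.inr ⟨F.1, ⟨fun k => ?_, F.2⟩, rfl⟩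
      rwa [node_eq_node_iff.2 (show T.Glued 0 k i by rw [Glued, T.glued_zero]; trivial)]

end Subtrees

/-- The vectors of the tree are supported exactly on the branches through their nodes: a component
of a node is zero if and only if the node is not in the corresponding branch. -/
def IsSupportedOnBranches (T : VectorTree r) : Prop :=
  ∀ i j h, T.nodeVec (T.node i j) h = 0 ↔ ¬ T.Glued j i h

namespace IsSupportedOnBranches

variable (hT : T.IsSupportedOnBranches) {F G : T.Subtree} {i : Fin r}
include hT

theorem branchSeq_pos (i : Fin r) (j : ℕ) : 0 < T.branchSeq i j :=
  Nat.pos_of_ne_zero fun h => (hT i j i).1 h ((T.glued j).refl i)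

theorem sum_apply (F : T.Subtree) (i : Fin r) :
    F.sum i = ∑ j ∈ range (F.height i), T.branchSeq i j := by
  have hzero : ∀ v ∈ F.1, T.nodeVec v i ≠ 0 → i ∈ T.branchesThrough v := by
    intro v _ hv
    obtain ⟨k, j, rfl⟩ := exists_node_eq v
    exact mem_branchesThrough_node.2 ((T.glued j).symm (not_not.1 (mt (hT k j i).2 hv)))
  rw [Subtree.sum, Finset.sum_apply, ← sum_filter_of_ne hzero, F.filter_mem_branchesThrough,
    sum_map]
  rfl

theorem sum_truncation (j : ℕ) :
    (Subtree.truncation T j).sum = fun i => ∑ l ∈ range j, T.branchSeq i l :=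
  funext fun i => by rw [hT.sum_apply, Subtree.height_truncation]

theorem sum_apply_mem_arfNumericalSet (F : T.Subtree) (i : Fin r) :
    F.sum i ∈ arfNumericalSet (T.branchSeq i) :=
  ⟨_, hT.sum_apply F i⟩

theorem height_eq_of_sum_apply_eq {m : ℕ} (h : F.sum i = ∑ j ∈ range m, T.branchSeq i j) :
    F.height i = m :=
  (strictMono_sum_range (hT.branchSeq_pos i)).injective ((hT.sum_apply F i).symm.trans h)

theorem sum_le_sum_iff : F.sum ≤ G.sum ↔ F ≤ G := by
  simp only [Pi.le_def, hT.sum_apply, Subtree.le_iff_height_le,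
    (strictMono_sum_range (hT.branchSeq_pos _)).le_iff_le]

/-- The isomorphism between the poset of finite subtrees and `S(T)` that sends a subtree to its
sum. -/
noncomputable def sumOrderIso {S : AddSubmonoid (Fin r → ℕ)}
    (hS : (S : Set (Fin r → ℕ)) = T.sums) : T.Subtree ≃o S :=
  (OrderEmbedding.ofMapLEIff Subtree.sum fun _ _ => hT.sum_le_sum_iff).orderIso.trans
    (OrderIso.setCongr _ (S : Set (Fin r → ℕ)) (hS ▸ Set.ext fun _ => mem_sums_iff.symm))

theorem card_eq_card_add_length {S : AddSubmonoid (Fin r → ℕ)}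
    (hS : (S : Set (Fin r → ℕ)) = T.sums) {m : ℕ} (h : HasSaturatedChain S F.sum G.sum m) :
    #G.1 = #F.1 + m := by
  obtain ⟨c, hhead, hlast, rfl⟩ := h
  let e := hT.sumOrderIso hS
  have hF : e.symm c.head = F := e.symm_apply_eq.2 (Subtype.ext hhead)
  have hG : e.symm c.last = G := e.symm_apply_eq.2 (Subtype.ext hlast)
  rw [← hF, ← hG]
  exact relSeries_apply_last (fun a => #(e.symm a).1)
    (fun _ _ hab => Subtree.card_of_covBy ((apply_covBy_apply_iff e.symm).2 hab)) c

section Conductor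

variable (hF : ∀ x, F.sum + x ∈ T.sums)
include hF

theorem Ici_sum_subset_arfNumericalSet (i : Fin r) :
    Set.Ici (∑ j ∈ range (F.height i), T.branchSeq i j) ⊆ arfNumericalSet (T.branchSeq i) := by
  intro y hy
  rw [Set.mem_Ici, ← hT.sum_apply] at hy
  obtain ⟨G, hG⟩ := mem_sums_iff.1 (hF (Pi.single i (y - F.sum i)))
  have hGi : G.sum i = y := by rw [hG, Pi.add_apply, Pi.single_eq_same, Nat.add_sub_cancel' hy]
  exact hGi ▸ hT.sum_apply_mem_arfNumericalSet G i

theorem card_branchesThrough_eq_one {v : T.Node} (hv : v ∉ F.1) :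
    #(T.branchesThrough v) = 1 := by
  obtain ⟨i, j, rfl⟩ := exists_node_eq v
  refine card_eq_one.2 ⟨i, eq_singleton_iff_unique_mem.2
    ⟨mem_branchesThrough.2 rfl, fun k hk => ?_⟩⟩
  have hnode : T.node k j = T.node i j := mem_branchesThrough.1 hk
  by_contra hki
  -- Raising only the coordinate `i` would add the node `v` without raising the branch `k`.
  have hle : F.sum i ≤ ∑ l ∈ range (j + 1), T.branchSeq i l := by
    rw [hT.sum_apply]
    exact (strictMono_sum_range (hT.branchSeq_pos i)).monotone
      ((not_lt.1 (mt Subtree.node_mem_iff.2 hv)).trans (Nat.le_succ j))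
  obtain ⟨G, hG⟩ := mem_sums_iff.1
    (hF (Pi.single i (∑ l ∈ range (j + 1), T.branchSeq i l - F.sum i)))
  have hGi : G.height i = j + 1 := hT.height_eq_of_sum_apply_eq <| by
    rw [hG, Pi.add_apply, Pi.single_eq_same, Nat.add_sub_cancel' hle]
  have hGk : G.height k = F.height k := hT.height_eq_of_sum_apply_eq <| by
    rw [hG, Pi.add_apply, Pi.single_eq_of_ne hki, add_zero, hT.sum_apply]
  have hvG : T.node k j ∈ G.1 := hnode ▸ Subtree.node_mem_iff.2 (hGi ▸ Nat.lt_succ_self j)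
  rw [Subtree.node_mem_iff, hGk, ← Subtree.node_mem_iff, hnode] at hvG
  exact hv hvG

theorem sum_sum_sub_card :
    (∑ i, F.sum i : ℤ) - #F.1 =
      ∑ i, (numericalGenus (arfNumericalSet (T.branchSeq i)) : ℤ) +
        ∑ᶠ v, ((#(T.branchesThrough v) : ℤ) - 1) := by
  have hsum : ∑ i, F.sum i = ∑ i, numericalGenus (arfNumericalSet (T.branchSeq i)) +
      ∑ v ∈ F.1, #(T.branchesThrough v) := by
    rw [F.sum_card_branchesThrough, ← sum_add_distrib]
    refine sum_congr rfl fun i _ => ?_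
    rw [hT.sum_apply, numericalGenus_arfNumericalSet_add (hT.branchSeq_pos i)
      (hT.Ici_sum_subset_arfNumericalSet hF i)]
  have hsupport : (Function.support fun v => (#(T.branchesThrough v) : ℤ) - 1) ⊆ F.1 := by
    refine Function.support_subset_iff'.2 fun v hv => ?_
    rw [hT.card_branchesThrough_eq_one hF hv, Nat.cast_one, sub_self]
  rw [finsum_eq_sum_of_support_subset _ hsupport, sum_sub_distrib, ← Nat.cast_sum _ F.sum, hsum,
    sum_const, nsmul_one]
  push_cast
  ring

end Conductor

end IsSupportedOnBranches

namespace IsMultiplicityTree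

variable {S : AddSubmonoid (Fin r → ℕ)} (hT : T.IsMultiplicityTree S)
include hT

theorem isSupportedOnBranches : T.IsSupportedOnBranches :=
  hT.eq_zero_iff

theorem mem_iff_mem_sums {x : Fin r → ℕ} : x ∈ S ↔ x ∈ T.sums := by
  rw [← hT.eq_sums, SetLike.mem_coe]

theorem isMultiplicitySequence (i : Fin r) : IsMultiplicitySequence (T.branchSeq i) := by
  have hb := hT.isSupportedOnBranches
  refine isMultiplicitySequence_of_mem_arfNumericalSet (hb.branchSeq_pos i) (fun j => ?_) ?_
  · have htrunc : ∀ m, (fun k => ∑ l ∈ range m, T.branchSeq k l) ∈ S := fun m =>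
      hT.mem_iff_mem_sums.2 (mem_sums_iff.2 ⟨_, hb.sum_truncation m⟩)
    have hlevel : (fun k => ∑ l ∈ range j, T.branchSeq k l) + (fun k => T.branchSeq k j) ∈ S := by
      convert htrunc (j + 1) using 1
      exact funext fun k => (sum_range_succ _ _).symm
    obtain ⟨F, hF⟩ := mem_sums_iff.1 (hT.mem_iff_mem_sums.1
      (hT.isLocalArf.arf _ (htrunc j) _ _ hlevel hlevel))
    have hFi : F.sum i = ∑ l ∈ range (j + 1), T.branchSeq i l + T.branchSeq i j := by
      rw [hF, sum_range_succ, add_assoc]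
      rfl
    exact hFi ▸ hb.sum_apply_mem_arfNumericalSet F i
  · obtain ⟨δ, hδ, hadd⟩ := hT.isLocalArf.good.exists_add_mem
    obtain ⟨F, rfl⟩ := mem_sums_iff.1 (hT.mem_iff_mem_sums.1 hδ)
    exact ⟨_, hb.Ici_sum_subset_arfNumericalSet (fun x => hT.mem_iff_mem_sums.1 (hadd x)) i⟩

theorem exists_isGenus : ∃ g, IsGenus S g := by
  obtain ⟨δ, hδ⟩ := hT.isLocalArf.good.exists_isConductor
  have hδS : δ ∈ S := add_zero δ ▸ hδ.1 0
  obtain ⟨m, hm⟩ := exists_hasSaturatedChain (AddSubmonoid.mem_top 0) (AddSubmonoid.mem_top δ)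
    (fun _ => Nat.zero_le _)
  obtain ⟨l, hl⟩ := exists_hasSaturatedChain S.zero_mem hδS (fun _ => Nat.zero_le _)
  exact ⟨_, δ, m, l, hδ, hm, hl, rfl⟩

theorem eq_of_isGenus {g : ℤ} (hg : IsGenus S g) :
    g = ∑ i, (numericalGenus (arfNumericalSet (T.branchSeq i)) : ℤ) +
      ∑ᶠ v, ((#(T.branchesThrough v) : ℤ) - 1) := by
  obtain ⟨δ, m, l, hδ, hm, hl, rfl⟩ := hg
  have hδS : δ ∈ S := add_zero δ ▸ hδ.1 0
  obtain ⟨F, rfl⟩ := mem_sums_iff.1 (hT.mem_iff_mem_sums.1 hδS)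
  rw [← hT.isSupportedOnBranches.sum_sum_sub_card fun x => hT.mem_iff_mem_sums.1 (hδ.1 x)]
  have hm' : ∑ i, F.sum i = m := by simpa using hm.sum_eq_sum_add_length
  rw [← Subtree.sum_truncation_zero (T := T)] at hl
  have hl' : #F.1 = l := by
    rw [hT.isSupportedOnBranches.card_eq_card_add_length hT.eq_sums hl,
      Subtree.truncation_zero_val, card_empty, zero_add]
  rw [← hm', hl', Nat.cast_sum]

end IsMultiplicityTree

section Untwisted

theorem IsHighestGluedLevel.glued_iff {i k : Fin r} {p : ℕ} (hp : T.IsHighestGluedLevel i k p)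
    {j : ℕ} : T.Glued j i k ↔ j < p := by
  refine ⟨fun hg => hp.2 ⟨j, rfl, hg⟩, fun hj => ?_⟩
  obtain ⟨l, rfl, hl⟩ := hp.1
  exact hl.mono (Nat.le_of_lt_succ hj)

variable {n : ℕ} {T : VectorTree (n + 1)}

theorem IsUntwisted.ordConnected_branchesThrough (hU : T.IsUntwisted) (v : T.Node) :
    (T.branchesThrough v : Set (Fin (n + 1))).OrdConnected := by
  obtain ⟨i, l, rfl⟩ := exists_node_eq v
  refine ⟨fun a ha b hb c hc => ?_⟩
  simp only [mem_coe, mem_branchesThrough_node] at ha hb ⊢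
  rcases hc.1.eq_or_lt with rfl | hac
  · exact ha
  have hab : T.Glued l a b := (T.glued l).trans ha ((T.glued l).symm hb)
  have hconsecutive := (hU l a b (hac.trans_le hc.2)).1 hab
  have hgac : T.Glued l a c :=
    (hU l a c hac).2 fun k hak hkc => hconsecutive k hak (hkc.trans hc.2)
  exact (T.glued l).trans ((T.glued l).symm hgac) ha

theorem IsUntwisted.finsum_card_branchesThrough_sub_one (hU : T.IsUntwisted) {p : Fin n → ℕ}
    (hp : ∀ k : Fin n, T.IsHighestGluedLevel k.castSucc k.succ (p k)) :
    ∑ᶠ v, ((#(T.branchesThrough v) : ℤ) - 1) = ∑ k, (p k : ℤ) := by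
  classical
  let shared (k : Fin n) : Finset T.Node :=
    (range (p k)).map ⟨T.node k.castSucc, T.node_injective _⟩
  have hshared : ∀ v k,
      k.castSucc ∈ T.branchesThrough v ∧ k.succ ∈ T.branchesThrough v ↔ v ∈ shared k := by
    intro v k
    simp only [shared, mem_map, mem_range, ← (hp k).glued_iff, Function.Embedding.coeFn_mk]
    constructor
    · rintro ⟨hk, hk'⟩
      rw [mem_branchesThrough] at hk hk'
      exact ⟨v.1, node_eq_node_iff.1 (hk.trans hk'.symm), hk⟩
    · rintro ⟨j, hj, rfl⟩
      exact ⟨mem_branchesThrough.2 rfl, mem_branchesThrough_node.2 ((T.glued j).symm hj)⟩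
  have hcard : ∀ v, (#(T.branchesThrough v) : ℤ) - 1 = ∑ k, if v ∈ shared k then 1 else 0 := by
    intro v
    rw [← card_filter_castSucc_succ_mem_add_one (branchesThrough_nonempty v)
      (hU.ordConnected_branchesThrough v), sum_boole]
    simp only [hshared, Nat.cast_add, Nat.cast_one, add_sub_cancel_right]
  have hsupport : ∀ k, (Function.support fun v => if v ∈ shared k then (1 : ℤ) else 0) ⊆ shared k :=
    fun k => Function.support_subset_iff'.2 fun v hv => if_neg hv
  rw [finsum_congr hcard,
    finsum_sum_comm _ _ fun k _ => (shared k).finite_toSet.subset (hsupport k)]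
  refine sum_congr rfl fun k _ => ?_
  rw [finsum_eq_sum_of_support_subset _ (hsupport k), sum_boole, filter_mem_eq_inter, inter_self,
    card_map, card_range]

end Untwisted

end VectorTree

theorem mainTheorem1_general {r : ℕ} (S : AddSubmonoid (Fin r → ℕ)) (T : VectorTree r)
    (hT : T.IsMultiplicityTree S) :
    (∀ k, IsMultiplicitySequence (T.branchSeq k)) ∧
      ∀ g : ℤ, IsGenus S g ↔
        g = (∑ k, (numericalGenus (arfNumericalSet (T.branchSeq k)) : ℤ)) +
          ∑ᶠ v, ((#(T.branchesThrough v) : ℤ) - 1) := by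
  refine ⟨hT.isMultiplicitySequence, fun g => ⟨hT.eq_of_isGenus, ?_⟩⟩
  rintro rfl
  obtain ⟨g, hg⟩ := hT.exists_isGenus
  exact hT.eq_of_isGenus hg ▸ hg

theorem mainTheorem1 {n : ℕ} (S : AddSubmonoid (Fin (n + 1) → ℕ)) (T : VectorTree (n + 1))
    (hT : T.IsMultiplicityTree S) (hU : T.IsUntwisted) (p : Fin n → ℕ)
    (hp : ∀ k : Fin n, T.IsHighestGluedLevel k.castSucc k.succ (p k)) :
    (∀ k, IsMultiplicitySequence (T.branchSeq k)) ∧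
      ∀ g : ℤ, IsGenus S g ↔
        g = (∑ k, (numericalGenus (arfNumericalSet (T.branchSeq k)) : ℤ)) + ∑ k, (p k : ℤ) := by
  rw [← hU.finsum_card_branchesThrough_sub_one hp]
  exact mainTheorem1_general S T hT
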